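/- Let $n>s\ge 1$ be integers with $\gcd(n,s)=1$, let $a,b\in\mathbb Z$, and put $$g(t)=t^n-1,\qquad f(t)=b\sum_{i=0}^{s-1}t^i+a\sum_{i=s}^{n-1}t^i .$$ Let $C_g\in\mathbb Z^{n\times n}$ be the companion matrix of $g$: for $g(t)=t^n+g_{n-1}t^{n-1}+\dots+g_0$ its first row is $(-g_{n-1},\dots,-g_1,-g_0)$, its subdiagonal entries are $1$, and all its other entries are $0$. Thus $f(C_g)$ is the integer circulant matrix whose first column is $(b,\dots,b,a,\dots,a)^T$, with $b$ occurring $s$ times and $a$ occurring $n-s$ times. Put $$k=\frac{|a(n-s)+sb|}{\gcd(a,b)}$$ (with $k:=0$ if $a=b=0$). Then the invariant factors of $f(C_g)$ are $$\gcd(a,b),\ \underbrace{|a-b|,\dots,|a-b|}_{n-2\ \text{times}},\ k\,|a-b| .$$ That is, each of these $n$ integers divides the next one, and there are matrices $U,V\in\mathbb Z^{n\times n}$ with determinant $\pm1$ such that $U f(C_g) V$ is the diagonal matrix with these diagonal entries, in this order (invariant factors are allowed to be zero). -/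

import Mathlib

open Polynomial

/-- The companion matrix `C_g` of a monic polynomial `g = t ^ n + g_{n-1} t ^ (n-1) + ⋯ + g_0`:
its first row is `-g_{n-1}, …, -g_1, -g_0`, its subdiagonal entries are `1`, and all
other entries are `0`. -/
def companionMatrix {R : Type*} [CommRing R] (n : ℕ) (g : R[X]) : Matrix (Fin n) (Fin n) R :=
  Matrix.of fun i j =>
    if (i : ℕ) = 0 then -g.coeff (n - 1 - (j : ℕ))
    else if (i : ℕ) = (j : ℕ) + 1 then 1
    else 0

/-- `d 0, d 1, …, d (n-1)` are the invariant factors of the square matrix `M`: each of them divides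
the next, and `U * M * V` is the diagonal matrix with these entries (the Smith form of `M`) for some
unimodular matrices `U` and `V`. Zero entries are allowed. -/
def HasInvariantFactors {R : Type*} [CommRing R] {n : ℕ} (M : Matrix (Fin n) (Fin n) R)
    (d : Fin n → R) : Prop :=
  (∀ i j : Fin n, (j : ℕ) = (i : ℕ) + 1 → d i ∣ d j) ∧
    ∃ U V : Matrix (Fin n) (Fin n) R,
      IsUnit U.det ∧ IsUnit V.det ∧ U * M * V = Matrix.diagonal d

/-! Let `P` be the cyclic shift, `J` the all-ones matrix, `S = 1 + P + ⋯ + P ^ (s-1)`. The circulant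
is `(b - a) S + a J`. As `s` is invertible mod `n`, `S` has an inverse modulo `J`, again a sum of
powers of `P`; a rank one correction makes it unimodular over `ℤ`. Multiplying by it leaves `c = b -
a` times the identity plus a rank one matrix. Two transvections confine that perturbation to a
coordinate plane, giving the block `!![d * x, d * y; 0, c]` with `d = gcd(a, b)`, `x, y` coprime and
`|x| = k`. Its Smith form is `d, c * x`; the other `n - 2` entries are `c`. -/

section PlaneMatrix

variable {ι R : Type*} [DecidableEq ι] [CommRing R]

/-- The matrix acting as `A` on the coordinates `p`, `q` and as the scalar `c` elsewhere. -/
def planeMatrix (p q : ι) (c : R) (A : Matrix (Fin 2) (Fin 2) R) : Matrix ι ι R :=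
  let e : Matrix ι (Fin 2) R := (Matrix.of ![Pi.single p 1, Pi.single q 1]).transpose
  c • (1 - e * e.transpose) + e * A * e.transpose

theorem planeMatrix_one (p q : ι) : planeMatrix p q (1 : R) 1 = 1 := by
  simp [planeMatrix]

theorem planeMatrix_apply (p q : ι) (c : R) (A : Matrix (Fin 2) (Fin 2) R) (i j : ι) :
    planeMatrix p q c A i j =
      c * ((if i = j then 1 else 0) - ((if i = p then 1 else 0) * (if j = p then 1 else 0) +
        (if i = q then 1 else 0) * (if j = q then 1 else 0))) +
      (((if i = p then 1 else 0) * A 0 0 + (if i = q then 1 else 0) * A 1 0) *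
          (if j = p then 1 else 0) +
        ((if i = p then 1 else 0) * A 0 1 + (if i = q then 1 else 0) * A 1 1) *
          (if j = q then 1 else 0)) := by
  simp only [planeMatrix, Matrix.add_apply, Matrix.smul_apply, Matrix.sub_apply, Matrix.mul_apply,
    Fin.sum_univ_two, Matrix.transpose_apply, Matrix.of_apply, Matrix.one_apply,
    Pi.single_apply,
    Matrix.cons_val_zero, Matrix.cons_val_one, smul_eq_mul]

theorem planeMatrix_upperTriangular {p q : ι} (hpq : p ≠ q) (c x y : R) :
    planeMatrix p q c !![x, y; 0, c] = c • (1 : Matrix ι ι R) +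
      Matrix.vecMulVec (Pi.single p 1) ((x - c) • Pi.single p 1 + y • Pi.single q 1) := by
  ext i j
  rw [planeMatrix_apply]
  by_cases hi : i = p
  · by_cases hj : j = p
    · simp [Matrix.vecMulVec_apply, hi, hj, hpq]
    · by_cases hj' : j = q <;>
      simp [Matrix.vecMulVec_apply, hi, hj', hj, hpq, hpq.symm, Matrix.one_apply]
  · by_cases hi' : i = q <;> by_cases hj : j = q <;>
      simp [Matrix.vecMulVec_apply, Pi.single_apply, hi, hi', hj, hpq.symm, Matrix.one_apply]

theorem planeMatrix_diagonal {p q : ι} (hpq : p ≠ q) (c x y : R) :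
    planeMatrix p q c !![x, 0; 0, y] =
      Matrix.diagonal fun i => if i = p then x else if i = q then y else c := by
  ext i j
  rw [planeMatrix_apply, Matrix.diagonal_apply]
  by_cases hij : i = j
  · subst hij
    by_cases hi : i = p
    · simp [hi, hpq]
    · by_cases hi' : i = q <;> simp [hi, hi', hpq.symm]
  · by_cases hi : i = p
    · have : j ≠ p := fun h => hij (hi.trans h.symm)
      simp [hi, this, this.symm, hpq]
    · by_cases hi' : i = q
      · have : j ≠ q := fun h => hij (hi'.trans h.symm)
        simp [hi', this, this.symm, hpq.symm]
      · simp [hi, hi', hij]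

end PlaneMatrix

/-! ### Unimodular equivalence and elementary reductions -/

section UnimodularEquivalence

variable {ι R : Type*} [Fintype ι] [DecidableEq ι] [CommRing R]

/-- Two square matrices are unimodularly equivalent if `U * M * V = N` for unimodular `U`, `V`. -/
def UnimodularEquiv (M N : Matrix ι ι R) : Prop :=
  ∃ U V : Matrix ι ι R, IsUnit U.det ∧ IsUnit V.det ∧ U * M * V = N

theorem UnimodularEquiv.trans {M N K : Matrix ι ι R} (h₁ : UnimodularEquiv M N)
    (h₂ : UnimodularEquiv N K) : UnimodularEquiv M K := by
  obtain ⟨U, V, hU, hV, rfl⟩ := h₁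
  obtain ⟨U', V', hU', hV', rfl⟩ := h₂
  refine ⟨U' * U, V * V', ?_, ?_, by simp only [mul_assoc]⟩
  · rw [Matrix.det_mul]; exact hU'.mul hU
  · rw [Matrix.det_mul]; exact hV.mul hV'

theorem isUnit_det_of_mul_eq_one {A B : Matrix ι ι R} (h : A * B = 1) :
    IsUnit A.det ∧ IsUnit B.det := by
  have h' : A.det * B.det = 1 := by rw [← Matrix.det_mul, h, Matrix.det_one]
  exact ⟨IsUnit.of_mul_eq_one _ h', IsUnit.of_mul_eq_one_right _ h'⟩

theorem unimodularEquiv_diagonal_of_associated {d d' : ι → R} (h : ∀ i, Associated (d i) (d' i)) :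
    UnimodularEquiv (Matrix.diagonal d) (Matrix.diagonal d') := by
  choose u hu using h
  refine ⟨1, Matrix.diagonal fun i => (u i : R), by simp, ?_, ?_⟩
  · rw [Matrix.det_diagonal]
    exact IsUnit.prod_univ_iff.2 fun i => (u i).isUnit
  · simp [Matrix.diagonal_mul_diagonal, hu]

/-- Since `vᵀ u = 0`, the matrix `u vᵀ` squares to zero. -/
theorem one_add_vecMulVec_mul_one_sub {u v : ι → R} (h : v ⬝ᵥ u = 0) :
    (1 + Matrix.vecMulVec u v) * (1 - Matrix.vecMulVec u v) = 1 := by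
  simp [mul_sub, add_mul, Matrix.vecMulVec_mul_vecMulVec, h]

/-- Conjugating a rank one perturbation of a scalar matrix by `1 + u vᵀ`, where `vᵀ u = 0`. -/
theorem unimodularEquiv_smul_one_add_vecMulVec (c : R) (p q : ι → R) {u v : ι → R}
    (h : v ⬝ᵥ u = 0) :
    UnimodularEquiv (c • (1 : Matrix ι ι R) + Matrix.vecMulVec p q)
      (c • (1 : Matrix ι ι R) + Matrix.vecMulVec (p + (v ⬝ᵥ p) • u) (q - (q ⬝ᵥ u) • v)) := by
  have h1 := one_add_vecMulVec_mul_one_sub h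
  refine ⟨_, _, (isUnit_det_of_mul_eq_one h1).1, (isUnit_det_of_mul_eq_one h1).2, ?_⟩
  rw [mul_add, add_mul, mul_smul_comm, mul_one, smul_mul_assoc, h1, Matrix.mul_vecMulVec,
    Matrix.vecMulVec_mul]
  congr 2
  · simp [Matrix.add_mulVec, Matrix.vecMulVec_mulVec]
  · simp [Matrix.vecMul_sub, Matrix.vecMul_vecMulVec]

theorem planeMatrix_mul {p q : ι} (hpq : p ≠ q) (c c' : R) (A B : Matrix (Fin 2) (Fin 2) R) :
    planeMatrix p q c A * planeMatrix p q c' B = planeMatrix p q (c * c') (A * B) := by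
  simp only [planeMatrix]
  set e : Matrix ι (Fin 2) R := (Matrix.of ![Pi.single p 1, Pi.single q 1]).transpose with he_def
  have he : e.transpose * e = 1 := by
    ext i j
    rw [Matrix.mul_apply]
    fin_cases i <;> fin_cases j <;> simp [he_def, Pi.single_apply, hpq, hpq.symm]
  have h1 (X : Matrix ι (Fin 2) R) (Y : Matrix (Fin 2) ι R) :
      X * e.transpose * (e * Y) = X * Y := by
    rw [Matrix.mul_assoc, ← Matrix.mul_assoc e.transpose, he, Matrix.one_mul]
  have h2 : (1 - e * e.transpose) * (1 - e * e.transpose) = 1 - e * e.transpose := by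
    simp [sub_mul, mul_sub, h1]
  have h3 : (1 - e * e.transpose) * (e * B * e.transpose) = 0 := by
    rw [Matrix.mul_assoc e]
    simp [sub_mul, h1]
  have h4 : e * A * e.transpose * (1 - e * e.transpose) = 0 := by
    simp [mul_sub, h1]
  have h5 : e * A * e.transpose * (e * B * e.transpose) = e * (A * B) * e.transpose := by
    rw [Matrix.mul_assoc e B, h1]
    simp only [Matrix.mul_assoc]
  simp [mul_add, add_mul, h2, h3, h4, h5, smul_smul, mul_comm]

theorem unimodularEquiv_planeMatrix {p q : ι} (hpq : p ≠ q) (c : R)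
    {A B : Matrix (Fin 2) (Fin 2) R} (h : UnimodularEquiv A B) :
    UnimodularEquiv (planeMatrix p q c A) (planeMatrix p q c B) := by
  obtain ⟨U, V, hU, hV, rfl⟩ := h
  have key {W : Matrix (Fin 2) (Fin 2) R} (hW : IsUnit W.det) :
      IsUnit (planeMatrix p q 1 W).det := by
    refine (isUnit_det_of_mul_eq_one (B := planeMatrix p q 1 W⁻¹) ?_).1
    rw [planeMatrix_mul hpq, Matrix.mul_nonsing_inv _ hW, mul_one, planeMatrix_one]
  refine ⟨_, _, key hU, key hV, ?_⟩
  rw [planeMatrix_mul hpq, planeMatrix_mul hpq, one_mul, mul_one]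

/-- Smith form of an upper triangular `2 × 2` matrix whose top row generates the ideal `(d)`
containing the last entry. -/
theorem unimodularEquiv_fin_two {c d x y r t : R} (hd : r * (d * x) + t * (d * y) = d)
    (hrt : r * x + t * y = 1) (hc : d ∣ c) :
    UnimodularEquiv !![d * x, d * y; 0, c] !![d, 0; 0, c * x] := by
  obtain ⟨e, rfl⟩ := hc
  -- The column operation turns the top row into `(d, 0)`; the row operation then clears the entry
  -- `c * t` below `d`.
  refine ⟨!![1, 0; -(e * t), 1], !![r, -y; t, x], by simp, ?_, ?_⟩
  · have : r * x + y * t = 1 := by rw [← hrt]; ring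
    simp [Matrix.det_fin_two_of, this]
  · ext i j
    fin_cases i <;> fin_cases j <;> simp [Matrix.mul_apply, Fin.sum_univ_two]
    · linear_combination hd
    · ring
    · linear_combination (-(e * t)) * hd
    · ring

end UnimodularEquivalence

/-! ### Powers of the cyclic shift and reduction to a plane -/

section CyclicShift

open scoped Fin.NatCast

variable {R : Type*} [CommRing R]

/-- Each exponent below `p * q` is uniquely `i + p * j` with `i < p`, `j < q`. -/
theorem geom_sum_mul_eq {A : Type*} [Semiring A] (x : A) (p q : ℕ) :
    ∑ i ∈ Finset.range (p * q), x ^ i =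
      (∑ i ∈ Finset.range p, x ^ i) * ∑ j ∈ Finset.range q, x ^ (p * j) := by
  induction q with
  | zero => simp
  | succ q ih =>
    rw [Nat.mul_succ, Finset.sum_range_add, ih, Finset.sum_range_succ _ q, mul_add]
    congr 1
    rw [Finset.sum_mul]
    exact Finset.sum_congr rfl fun i _ => by rw [← pow_add, add_comm]

theorem companionMatrix_X_pow_sub_one_apply {n : ℕ} [NeZero n] (hn : 2 ≤ n) (i j : Fin n) :
    companionMatrix n (X ^ n - 1 : R[X]) i j = if i = j + 1 then 1 else 0 := by
  have hi := i.isLt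
  have hj := j.isLt
  have h1 : (1 : Fin n).val = 1 := by rw [Fin.val_one', Nat.mod_eq_of_lt hn]
  have hij : i = j + 1 ↔ (i : ℕ) = (j + 1) % n := by rw [Fin.ext_iff, Fin.val_add, h1]
  have hco : (X ^ n - 1 : R[X]).coeff (n - 1 - (j : ℕ)) =
      if (j : ℕ) = n - 1 then -1 else 0 := by
    rw [coeff_sub, coeff_X_pow, coeff_one, if_neg (by omega)]
    by_cases h : (j : ℕ) = n - 1
    · simp [h]
    · rw [if_neg h, if_neg (by omega), sub_zero]
  simp only [companionMatrix, Matrix.of_apply, hco, hij]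
  by_cases h : (j : ℕ) = n - 1
  · have : ((j : ℕ) + 1) % n = 0 := by rw [h, Nat.sub_add_cancel (by omega), Nat.mod_self]
    rw [this, if_pos h, neg_neg, if_neg (c := (i : ℕ) = j + 1) (by omega)]
  · rw [Nat.mod_eq_of_lt (a := (j : ℕ) + 1) (by omega), if_neg h, neg_zero]
    split_ifs <;> first | rfl | omega

theorem companionMatrix_pow_apply {n : ℕ} [NeZero n] (hn : 2 ≤ n) (k : ℕ) (i j : Fin n) :
    (companionMatrix n (X ^ n - 1 : R[X]) ^ k) i j = if i = j + (k : Fin n) then 1 else 0 := by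
  induction k generalizing i j with
  | zero => simp [Matrix.one_apply]
  | succ k ih =>
    rw [pow_succ, Matrix.mul_apply]
    simp only [ih, companionMatrix_X_pow_sub_one_apply hn]
    rw [Finset.sum_eq_single (j + 1)]
    · simp only [Nat.cast_succ, if_true, mul_one, add_assoc, add_comm (k : Fin n)]
    · intro l _ hl
      simp [hl]
    · simp

theorem companionMatrix_pow_self {n : ℕ} (hn : 2 ≤ n) :
    companionMatrix n (X ^ n - 1 : R[X]) ^ n = 1 := by
  have : NeZero n := ⟨by omega⟩
  ext i j
  rw [companionMatrix_pow_apply hn]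
  simp [Matrix.one_apply]

theorem companionMatrix_pow_mulVec_one {n : ℕ} (hn : 2 ≤ n) (k : ℕ) :
    (companionMatrix n (X ^ n - 1 : R[X]) ^ k).mulVec 1 = 1 := by
  have : NeZero n := ⟨by omega⟩
  ext i
  simp only [Matrix.mulVec, dotProduct, companionMatrix_pow_apply hn, ← sub_eq_iff_eq_add]
  simp

theorem one_vecMul_companionMatrix_pow {n : ℕ} (hn : 2 ≤ n) (k : ℕ) :
    Matrix.vecMul 1 (companionMatrix n (X ^ n - 1 : R[X]) ^ k) = 1 := by
  have : NeZero n := ⟨by omega⟩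
  ext i
  simp only [Matrix.vecMul, dotProduct, companionMatrix_pow_apply hn]
  simp

theorem geom_sum_companionMatrix {n : ℕ} (hn : 2 ≤ n) :
    ∑ i ∈ Finset.range n, companionMatrix n (X ^ n - 1 : R[X]) ^ i = Matrix.vecMulVec 1 1 := by
  have : NeZero n := ⟨by omega⟩
  ext i j
  simp only [Matrix.sum_apply, companionMatrix_pow_apply hn]
  rw [Finset.sum_range]
  simp only [Fin.cast_val_eq_self, ← sub_eq_iff_eq_add']
  simp [Matrix.vecMulVec_apply]

/-- If `s r = m n + 1` then `c (1 + P + ⋯ + P ^ (s-1)) + a J`, where `P` is the cyclic shift and `J`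
the all ones matrix, is equivalent to a rank one perturbation of the scalar matrix `c`. -/
theorem unimodularEquiv_geom_sum_companionMatrix {n : ℕ} [NeZero n] (hn : 2 ≤ n) {s r m : ℕ}
    (h : s * r = n * m + 1) (c a : R) :
    UnimodularEquiv
      (c • ∑ i ∈ Finset.range s, companionMatrix n (X ^ n - 1 : R[X]) ^ i +
        a • Matrix.vecMulVec 1 1)
      (c • (1 : Matrix (Fin n) (Fin n) R) + Matrix.vecMulVec 1 ((c * m + a * r) • 1 +
        ((1 - r) * (c * s + a * n)) • Pi.single (0 : Fin n) 1)) := by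
  have hR : (s : R) * r = n * m + 1 := by exact_mod_cast congrArg (Nat.cast (R := R)) h
  set P := companionMatrix n (X ^ n - 1 : R[X]) with hP
  set S := ∑ i ∈ Finset.range s, P ^ i with hS
  set T := ∑ j ∈ Finset.range r, P ^ (s * j) with hT
  set e : Fin n → R := Pi.single 0 1 with he
  have hST : S * T = 1 + (m : R) • Matrix.vecMulVec 1 1 := by
    -- The `n * m + 1` powers form `m` full periods, each summing to `J`, plus `P ^ (n * m) = 1`.
    rw [← geom_sum_mul_eq, h, Finset.sum_range_succ, geom_sum_mul_eq, geom_sum_companionMatrix hn]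
    simp only [pow_mul, companionMatrix_pow_self hn, hP, one_pow]
    simp [add_comm, Nat.cast_smul_eq_nsmul, ← nsmul_eq_mul']
  have hS1 : S.mulVec 1 = (s : R) • 1 := by
    simp [hS, Matrix.sum_mulVec, hP, companionMatrix_pow_mulVec_one hn, Nat.cast_smul_eq_nsmul]
  have hT1 : T.mulVec 1 = (r : R) • 1 := by
    simp [hT, Matrix.sum_mulVec, hP, companionMatrix_pow_mulVec_one hn, Nat.cast_smul_eq_nsmul]
  have h1T : Matrix.vecMul 1 T = (r : R) • 1 := by
    simp [hT, Matrix.vecMul_sum, hP, one_vecMul_companionMatrix_pow hn, Nat.cast_smul_eq_nsmul]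
  have he1 : e ⬝ᵥ 1 = 1 := by simp [he]
  have h11 : (1 : Fin n → R) ⬝ᵥ 1 = n := by simp
  -- `T` scales the all-ones vector by `r`; the correction makes `V` fix it.
  set V := T + (1 - (r : R)) • Matrix.vecMulVec 1 e with hV
  have hSV : S * V = 1 + (m : R) • Matrix.vecMulVec 1 1 +
      ((1 - r) * s : R) • Matrix.vecMulVec 1 e := by
    rw [hV, mul_add, hST, mul_smul_comm, Matrix.mul_vecMulVec, hS1, Matrix.smul_vecMulVec,
      smul_smul]
  have h1V : Matrix.vecMul 1 V = (r : R) • 1 + ((1 - r) * n : R) • e := by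
    rw [hV, Matrix.vecMul_add, h1T, Matrix.vecMul_smul, Matrix.vecMul_vecMulVec, h11, smul_smul]
  have heV : Matrix.vecMul e V = Matrix.vecMul e T + (1 - r : R) • e := by
    rw [hV, Matrix.vecMul_add, Matrix.vecMul_smul, Matrix.vecMul_vecMulVec, he1, one_smul]
  have hunit : IsUnit V.det := by
    set z : Fin n → R := (m : R) • 1 + ((1 - r) * s : R) • e +
      (1 - s : R) • (Matrix.vecMul e T + (1 - r : R) • e)
    -- `S` corrected likewise is an inverse of `V` up to a transvection, so `V` is unimodular.
    have hz : (S + (1 - s : R) • Matrix.vecMulVec 1 e) * V = 1 + Matrix.vecMulVec 1 z := by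
      rw [add_mul, hSV, smul_mul_assoc, Matrix.vecMulVec_mul, heV]
      simp only [z, Matrix.vecMulVec_add, Matrix.vecMulVec_smul, add_assoc]
    have hz1 : z ⬝ᵥ 1 = 0 := by
      simp only [z, add_dotProduct, smul_dotProduct, he1, h11, ← Matrix.dotProduct_mulVec, hT1,
        dotProduct_smul, smul_eq_mul]
      linear_combination -hR
    have h2 := (isUnit_det_of_mul_eq_one (one_add_vecMulVec_mul_one_sub hz1)).1
    rw [← hz, Matrix.det_mul] at h2
    exact isUnit_of_mul_isUnit_right h2
  refine ⟨1, V, by simp, hunit, ?_⟩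
  rw [one_mul, add_mul, smul_mul_assoc, smul_mul_assoc, hSV, Matrix.vecMulVec_mul, h1V]
  simp only [Matrix.vecMulVec_add, Matrix.vecMulVec_smul]
  module

theorem unimodularEquiv_planeMatrix_of_rank_one {n : ℕ} [NeZero n] {l : Fin n} (hl : l ≠ 0)
    (c α β : R) :
    UnimodularEquiv (c • (1 : Matrix (Fin n) (Fin n) R) +
        Matrix.vecMulVec 1 (α • 1 + β • Pi.single (0 : Fin n) 1))
      (planeMatrix 0 l c !![c + n * α + β, α; 0, c]) := by
  set e : Fin n → R := Pi.single 0 1 with he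
  set e' : Fin n → R := Pi.single l 1 with he'
  have he1 : e ⬝ᵥ 1 = 1 := by simp [he]
  have h1e : 1 ⬝ᵥ e = 1 := by simp [he]
  have h1e' : 1 ⬝ᵥ e' = 1 := by simp [he']
  have h11 : (1 : Fin n → R) ⬝ᵥ 1 = n := by simp
  have hee : e ⬝ᵥ e = 1 := by simp [he]
  have hee' : e ⬝ᵥ e' = 0 := by simp [he, he', hl]
  have he'e' : e' ⬝ᵥ e' = 1 := by simp [he']
  have he'e : e' ⬝ᵥ e = 0 := by simp [he, he', hl]
  -- This transvection sends the column vector `1` to `e`; the next fixes `e` and clears the row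
  -- vector outside positions `0` and `l`.
  have h1 := unimodularEquiv_smul_one_add_vecMulVec c 1 (α • 1 + β • e) (u := e - 1) (v := e)
    (by rw [dotProduct_sub, hee, he1, sub_self])
  have h2 := unimodularEquiv_smul_one_add_vecMulVec c e
    ((n * α + β - α) • e + α • 1) (u := e') (v := 1 - e - e')
    (by simp only [sub_dotProduct, h1e', hee', he'e']; ring)
  have e1 : (1 : Fin n → R) + (e ⬝ᵥ 1) • (e - 1) = e := by rw [he1]; module
  have e2 : (α • 1 + β • e) - ((α • 1 + β • e) ⬝ᵥ (e - 1)) • e =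
      (n * α + β - α) • e + α • 1 := by
    simp only [add_dotProduct, smul_dotProduct, dotProduct_sub, h11, h1e, hee, he1, smul_eq_mul]
    module
  have e3 : e + ((1 - e - e') ⬝ᵥ e) • e' = e := by
    simp only [sub_dotProduct, h1e, hee, he'e]
    module
  have e4 : ((n * α + β - α) • e + α • 1) -
      (((n * α + β - α) • e + α • 1) ⬝ᵥ e') • (1 - e - e') =
      (c + n * α + β - c) • e + α • e' := by
    simp only [add_dotProduct, smul_dotProduct, hee', h1e', smul_eq_mul]
    module
  rw [e1, e2] at h1
  rw [e3, e4] at h2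
  rw [planeMatrix_upperTriangular hl.symm]
  exact h1.trans h2

end CyclicShift

/-! ### The main theorem -/

theorem theorem4p5 (n s : ℕ) (hs : 1 ≤ s) (hsn : s < n) (hcop : Nat.gcd n s = 1)
    (a b k : ℤ) (f g : ℤ[X])
    (hg : g = X ^ n - 1)
    (hf : f = C b * ∑ i ∈ Finset.range s, X ^ i + C a * ∑ i ∈ Finset.Ico s n, X ^ i)
    (hk : k = |a * ((n : ℤ) - (s : ℤ)) + (s : ℤ) * b| / (Int.gcd a b : ℤ)) :
    HasInvariantFactors (aeval (companionMatrix n g) f)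
      (fun i : Fin n =>
        if (i : ℕ) = 0 then (Int.gcd a b : ℤ)
        else if (i : ℕ) < n - 1 then |a - b|
        else k * |a - b|) := by
  have hn : 2 ≤ n := by omega
  have : NeZero n := ⟨by omega⟩
  have hdab : (Int.gcd a b : ℤ) ∣ |a - b| :=
    (dvd_abs _ _).2 (dvd_sub (Int.gcd_dvd_left ..) (Int.gcd_dvd_right ..))
  refine ⟨fun i j hij => ?_, ?_⟩
  · have hi := i.isLt
    have hj := j.isLt
    simp only
    rw [if_neg (c := (j : ℕ) = 0) (by omega)]
    split_ifs
    · exact hdab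
    · exact hdab.mul_left k
    · exact dvd_rfl
    · exact dvd_mul_left _ _
    · omega
    · omega
  change UnimodularEquiv _ _
  subst hg
  have hM : aeval (companionMatrix n (X ^ n - 1 : ℤ[X])) f =
      (b - a) • ∑ i ∈ Finset.range s, companionMatrix n (X ^ n - 1 : ℤ[X]) ^ i +
        a • Matrix.vecMulVec 1 1 := by
    rw [hf, ← geom_sum_companionMatrix hn, ← Finset.sum_range_add_sum_Ico _ hsn.le]
    simp only [map_add, map_mul, map_sum, map_pow, aeval_X, aeval_C, Algebra.algebraMap_eq_smul_one,
      smul_mul_assoc, one_mul]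
    module
  rw [hM]
  obtain ⟨r, m, hrm⟩ : ∃ r m, s * r = n * m + 1 := by
    obtain ⟨r, -, hr⟩ := Nat.exists_mul_mod_eq_one_of_coprime (k := n) (n := s)
      (Nat.coprime_comm.1 hcop) (by omega)
    exact ⟨r, s * r / n, by rw [← hr]; exact (Nat.div_add_mod _ _).symm⟩
  have hZ : (s : ℤ) * r = n * m + 1 := by exact_mod_cast hrm
  -- For `a = b = 0` everything vanishes; otherwise the gcd can be cancelled.
  rcases Nat.eq_zero_or_pos (Int.gcd a b) with hd0 | hdpos
  · obtain ⟨rfl, rfl⟩ := Int.gcd_eq_zero_iff.1 hd0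
    refine ⟨1, 1, by simp, by simp, ?_⟩
    ext i j
    simp [Matrix.diagonal_apply]
  set l : Fin n := ⟨n - 1, by omega⟩ with hl
  have hl0 : l ≠ 0 := by
    rw [Ne, Fin.ext_iff, Fin.val_zero]
    simp only [hl]
    omega
  obtain ⟨a', ha⟩ := Int.gcd_dvd_left a b
  obtain ⟨b', hb⟩ := Int.gcd_dvd_right a b
  have hbez := Int.gcd_eq_gcd_ab a b
  set d : ℤ := (Int.gcd a b : ℤ) with hd
  have hd0 : d ≠ 0 := by positivity
  set x : ℤ := (b' - a') * s + a' * n with hx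
  set y : ℤ := (b' - a') * m + a' * r with hy
  have hbez' : Int.gcdA a b * a' + Int.gcdB a b * b' = 1 := by
    apply mul_left_cancel₀ hd0
    linear_combination (-1 : ℤ) * hbez - Int.gcdA a b * ha - Int.gcdB a b * hb
  -- `(x, y)` is the image of `(b' - a', a')` under a unimodular map, so it is primitive too
  have h1 : b' - a' = r * x - n * y := by
    rw [hx, hy]; linear_combination (-(b' - a')) * hZ
  have h2 : a' = -m * x + s * y := by
    rw [hx, hy]; linear_combination (-a') * hZ
  -- Substitute `h1` and `h2` into the Bézout relation, rewritten as `(A + B) a' + B (b' - a') = 1`.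
  obtain ⟨p, q, hpq⟩ : ∃ p q : ℤ, p * x + q * y = 1 :=
    ⟨(Int.gcdA a b + Int.gcdB a b) * (-m) + Int.gcdB a b * r,
      (Int.gcdA a b + Int.gcdB a b) * s - Int.gcdB a b * n, by
      linear_combination hbez' - (Int.gcdA a b + Int.gcdB a b) * h2 - Int.gcdB a b * h1⟩
  have hkx : k = |x| := by
    rw [hk, show a * ((n : ℤ) - s) + s * b = d * x by
      rw [hx]; linear_combination ((n : ℤ) - s) * ha + s * hb, abs_mul,
      abs_of_pos (show 0 < d by positivity)]
    exact Int.mul_ediv_cancel_left _ hd0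
  refine (unimodularEquiv_geom_sum_companionMatrix hn hrm (b - a) a).trans ?_
  refine (unimodularEquiv_planeMatrix_of_rank_one hl0 _ _ _).trans ?_
  have hA : (b - a) + (n : ℤ) * ((b - a) * m + a * r) + (1 - r) * ((b - a) * s + a * n) =
      d * x := by
    rw [hx]
    linear_combination (-(b - a)) * hZ + (s : ℤ) * hb + ((n : ℤ) - s) * ha
  have hB : (b - a) * m + a * r = d * y := by
    rw [hy]
    linear_combination (m : ℤ) * hb + ((r : ℤ) - m) * ha
  rw [hA, hB]
  refine (unimodularEquiv_planeMatrix hl0.symm _ (unimodularEquiv_fin_two (r := p) (t := q)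
    (by linear_combination d * hpq) hpq ⟨b' - a', by linear_combination hb - ha⟩)).trans ?_
  rw [planeMatrix_diagonal hl0.symm]
  refine unimodularEquiv_diagonal_of_associated fun i => ?_
  have hi := i.isLt
  have hi0 : i = 0 ↔ (i : ℕ) = 0 := by rw [Fin.ext_iff, Fin.val_zero]
  have hil : i = l ↔ (i : ℕ) = n - 1 := by rw [Fin.ext_iff]
  simp only [hi0, hil]
  split_ifs
  · rfl
  · omega
  · rw [hkx, ← abs_mul, Int.associated_iff_natAbs, Int.natAbs_abs, Int.natAbs_mul, Int.natAbs_mul,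
      mul_comm, ← Int.natAbs_neg (b - a), neg_sub]
  · rw [Int.associated_iff_natAbs, Int.natAbs_abs, ← Int.natAbs_neg (b - a), neg_sub]
  · omega
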